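/- Let $(X_k)_{k\ge1}$ and $(Y_k)_{k\ge1}$ be two independent sequences of independent standard Gaussian random variables, and let $S_i=\sum_{j=1}^i X_j$, $T_i=\sum_{j=1}^i Y_j$. For $n\ge 2$ let $$\theta_n=\frac{\frac1n\sum_{i=1}^nS_iT_i-\frac1{n^2}\big(\sum_{i=1}^nS_i\big)\big(\sum_{i=1}^nT_i\big)}{\sqrt{\frac1n\sum_{i=1}^nS_i^2-\frac1{n^2}\big(\sum_{i=1}^nS_i\big)^2}\,\sqrt{\frac1n\sum_{i=1}^nT_i^2-\frac1{n^2}\big(\sum_{i=1}^nT_i\big)^2}}$$ be the empirical correlation of the two walks. Put $f(\lambda)=\frac{(\lambda+2)+\sqrt{(\lambda+2)^2-4}}{2}$ and, for $s,t>0$ with $s\ne t$, $$A_n(s,t)=\frac{(s+2n)(t+2n)+4n^2}{[st(s+4n)(t+4n)]^{3/4}}\,\big[f(s/n)^n-f(s/n)^{-n}\big]^{-1/2}\big[f(t/n)^n-f(t/n)^{-n}\big]^{-1/2},$$ $$\begin{aligned}B_n(s,t)=\Bigg\{&\frac{n(s+t+4n)}{\sqrt{s^2+4ns}+\sqrt{t^2+4nt}}\Big[f(s/n)^nf(t/n)^n-f(s/n)^{-n}f(t/n)^{-n}\Big]\\&+\frac12\Big(\sqrt{s^2+4ns}+\sqrt{t^2+4nt}+s+t+4n\Big)\frac{f(s/n)^nf(t/n)^{-n}-f(t/n)^nf(s/n)^{-n}}{f(s/n)-f(t/n)}\Bigg\}\\&\times\big[f(s/n)^n-f(s/n)^{-n}\big]^{-3/2}\big[f(t/n)^n-f(t/n)^{-n}\big]^{-3/2}\,[st(s+4n)(t+4n)]^{-1/4}.\end{aligned}$$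 Then, for every $n\ge2$, $\theta_n^2$ is integrable, the function $-A_n+B_n$ is Lebesgue integrable on $(0,\infty)^2$, and $$E(\theta_n^2)=\frac14\int_0^\infty\!\!\int_0^\infty\big(-A_n(s,t)+B_n(s,t)\big)\,dt\,ds.$$ -/

import Mathlib

open MeasureTheory ProbabilityTheory Set

noncomputable section

/-- The random walk `S_i = X_1 + ⋯ + X_i`. Sequences are indexed from `0` here: `X k` is the
step written `X_{k+1}` in the usual indexing from `1`. -/
def walk {Ω : Type*} (X : ℕ → Ω → ℝ) (i : ℕ) (ω : Ω) : ℝ :=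
  ∑ j ∈ Finset.range i, X j ω

/-- `(1/n) ∑_{i=1}^n S_i T_i - (1/n²) (∑_{i=1}^n S_i) (∑_{i=1}^n T_i)`, where `S` and `T` are the
random walks with steps `X` and `Y`. -/
def empiricalCov {Ω : Type*} (X Y : ℕ → Ω → ℝ) (n : ℕ) (ω : Ω) : ℝ :=
  (1 / (n : ℝ)) * ∑ i ∈ Finset.Icc 1 n, walk X i ω * walk Y i ω
    - (1 / (n : ℝ) ^ 2) * (∑ i ∈ Finset.Icc 1 n, walk X i ω) * (∑ i ∈ Finset.Icc 1 n, walk Y i ω)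

/-- The empirical correlation `θ_n` of the random walks with steps `X` and `Y`. -/
def empiricalCorr {Ω : Type*} (X Y : ℕ → Ω → ℝ) (n : ℕ) (ω : Ω) : ℝ :=
  empiricalCov X Y n ω / (√(empiricalCov X X n ω) * √(empiricalCov Y Y n ω))

/-- `f(λ) = ((λ + 2) + √((λ + 2)² - 4)) / 2`. -/
def fRoot (l : ℝ) : ℝ := ((l + 2) + √((l + 2) ^ 2 - 4)) / 2

/-- `f(s/n)^n - f(s/n)^{-n}`. -/
def fDiff (n : ℕ) (s : ℝ) : ℝ := fRoot (s / n) ^ (n : ℤ) - fRoot (s / n) ^ (-(n : ℤ))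

/-- The first part of the integrand (it enters with a minus sign). -/
def integrandA (n : ℕ) (s t : ℝ) : ℝ :=
  ((s + 2 * n) * (t + 2 * n) + 4 * (n : ℝ) ^ 2)
      / (s * t * (s + 4 * n) * (t + 4 * n)) ^ (3 / 4 : ℝ)
    * fDiff n s ^ (-(1 / 2) : ℝ) * fDiff n t ^ (-(1 / 2) : ℝ)

/-- The second part of the integrand. On the diagonal `s = t`, a null set, its last quotient is
`0 / 0`. -/
def integrandB (n : ℕ) (s t : ℝ) : ℝ :=
  (n * (s + t + 4 * n) / (√(s ^ 2 + 4 * n * s) + √(t ^ 2 + 4 * n * t))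
      * (fRoot (s / n) ^ (n : ℤ) * fRoot (t / n) ^ (n : ℤ)
        - fRoot (s / n) ^ (-(n : ℤ)) * fRoot (t / n) ^ (-(n : ℤ)))
    + 1 / 2 * (√(s ^ 2 + 4 * n * s) + √(t ^ 2 + 4 * n * t) + s + t + 4 * n)
      * ((fRoot (s / n) ^ (n : ℤ) * fRoot (t / n) ^ (-(n : ℤ))
          - fRoot (t / n) ^ (n : ℤ) * fRoot (s / n) ^ (-(n : ℤ)))
        / (fRoot (s / n) - fRoot (t / n))))
    * fDiff n s ^ (-(3 / 2) : ℝ) * fDiff n t ^ (-(3 / 2) : ℝ)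
    * (s * t * (s + 4 * n) * (t + 4 * n)) ^ (-(1 / 4) : ℝ)

end

/-! ### The empirical covariance as a quadratic form -/

section Covariance

variable {Ω : Type*}

/-! With `m = n - 1`, the empirical covariance is a bilinear form `x ⬝ Q y` in the steps after the
first, where `Q` is the Green matrix of the discrete Laplacian: `Q * tridiagonal 2 m = n⁻¹ • 1`. So
`θ_n² = c² / (a b)` with `c = x ⬝ Q y`, `a = x ⬝ Q x`, `b = y ⬝ Q y`. Since `1 / a = ½ ∫ exp (-s a /
2) ds`, this equals `¼ ∫∫ c² exp (-(s a + t b) / 2)`, and Tonelli moves the expectation inside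
(`lintegral_diagDensity`).

By rotation invariance of the Gaussian law (`map_eigenCoord`), `Q` may be taken diagonal with
entries `κ i`. The expectation is then a product of one-dimensional Gaussian integrals, giving
`D(s)^(-1/2) D(t)^(-1/2) ∑ κ² / ((1 + s κ)(1 + t κ))` with `D(s) = det (1 + s Q)`.

Two facts close the computation. The tridiagonal determinant recursion gives `D(s) √(s² + 4ns) =
f(s/n)^n - f(s/n)^(-n)`. By partial fractions the sum is a divided difference of `(log D)'`, hence
explicit (`diagDensity_eq`): the factor `√(s² + 4ns)` produces `-A`, and `f^n - f^(-n)` produces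
`B`. -/

theorem empiricalCov_eq_sum_centered (X Y : ℕ → Ω → ℝ) {n : ℕ} (hn : n ≠ 0) (ω : Ω) :
    empiricalCov X Y n ω = (1 / (n : ℝ)) * ∑ i ∈ Finset.Icc 1 n,
      (walk X i ω - (1 / (n : ℝ)) * ∑ j ∈ Finset.Icc 1 n, walk X j ω) *
      (walk Y i ω - (1 / (n : ℝ)) * ∑ j ∈ Finset.Icc 1 n, walk Y j ω) := by
  have hn' : (n : ℝ) ≠ 0 := by exact_mod_cast hn
  set S := ∑ j ∈ Finset.Icc 1 n, walk X j ω with hS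
  set T := ∑ j ∈ Finset.Icc 1 n, walk Y j ω with hT
  have h : ∑ i ∈ Finset.Icc 1 n, (walk X i ω - (1 / (n : ℝ)) * S) *
      (walk Y i ω - (1 / (n : ℝ)) * T) =
      ∑ i ∈ Finset.Icc 1 n, walk X i ω * walk Y i ω - (1 / (n : ℝ)) * S * T := by
    have : ∀ i, (walk X i ω - (1 / (n : ℝ)) * S) * (walk Y i ω - (1 / (n : ℝ)) * T) =
        walk X i ω * walk Y i ω - (1 / (n : ℝ)) * T * walk X i ω - (1 / (n : ℝ)) * S * walk Y i ω
          + (1 / (n : ℝ)) * S * ((1 / (n : ℝ)) * T) := fun i => by ring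
    simp only [this, Finset.sum_add_distrib, Finset.sum_sub_distrib, ← Finset.mul_sum, ← hS, ← hT,
      Finset.sum_const, Nat.card_Icc, nsmul_eq_mul]
    simp
    field_simp
    ring
  rw [h, empiricalCov]
  field_simp
  ring

theorem empiricalCov_self_nonneg (X : ℕ → Ω → ℝ) {n : ℕ} (hn : n ≠ 0) (ω : Ω) :
    0 ≤ empiricalCov X X n ω := by
  rw [empiricalCov_eq_sum_centered X X hn]
  exact mul_nonneg (by positivity) (Finset.sum_nonneg fun i _ => mul_self_nonneg _)

/-- The covariance kernel of the discrete Brownian bridge, up to normalization. -/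
noncomputable def bridgeKernel (n j k : ℕ) : ℝ :=
  ((min j k : ℕ) - (j : ℝ) * k / n) / n

theorem bridgeKernel_comm (n j k : ℕ) : bridgeKernel n j k = bridgeKernel n k j := by
  simp only [bridgeKernel, min_comm j k]; ring

theorem walk_eq_sum_indicator (X : ℕ → Ω → ℝ) {n i : ℕ} (hi : i ≤ n) (ω : Ω) :
    walk X i ω = ∑ j ∈ Finset.range n, (if j < i then 1 else 0) * X j ω := by
  simp only [ite_mul, one_mul, zero_mul]
  rw [← Finset.sum_filter, walk]
  congr 1
  ext j
  simp only [Finset.mem_range, Finset.mem_filter]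
  omega

theorem sum_Icc_indicator_lt {n j : ℕ} (hj : j ≤ n) :
    ∑ i ∈ Finset.Icc 1 n, (if j < i then (1 : ℝ) else 0) = n - j := by
  rw [← Finset.sum_filter]
  have : (Finset.Icc 1 n).filter (fun i => j < i) = Finset.Icc (j + 1) n := by
    ext i; simp only [Finset.mem_filter, Finset.mem_Icc]; omega
  rw [this]
  simp only [Finset.sum_const, Nat.card_Icc, nsmul_eq_mul, mul_one]
  rw [Nat.cast_sub (by omega)]
  push_cast; ring

theorem sum_walk (X : ℕ → Ω → ℝ) (n : ℕ) (ω : Ω) :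
    ∑ i ∈ Finset.Icc 1 n, walk X i ω = ∑ j ∈ Finset.range n, ((n : ℝ) - j) * X j ω := by
  rw [Finset.sum_congr rfl fun i hi => walk_eq_sum_indicator X (Finset.mem_Icc.1 hi).2 ω,
    Finset.sum_comm]
  refine Finset.sum_congr rfl fun j hj => ?_
  rw [← Finset.sum_mul, sum_Icc_indicator_lt (Finset.mem_range.1 hj).le]

theorem sum_walk_mul_walk (X Y : ℕ → Ω → ℝ) (n : ℕ) (ω : Ω) :
    ∑ i ∈ Finset.Icc 1 n, walk X i ω * walk Y i ω =
      ∑ j ∈ Finset.range n, ∑ k ∈ Finset.range n, ((n : ℝ) - (max j k : ℕ)) * X j ω * Y k ω := by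
  have h : ∀ i ∈ Finset.Icc 1 n, walk X i ω * walk Y i ω =
      ∑ j ∈ Finset.range n, ∑ k ∈ Finset.range n,
        (if max j k < i then 1 else 0) * (X j ω * Y k ω) := by
    intro i hi
    rw [walk_eq_sum_indicator X (Finset.mem_Icc.1 hi).2, walk_eq_sum_indicator Y
      (Finset.mem_Icc.1 hi).2, Finset.sum_mul_sum]
    refine Finset.sum_congr rfl fun j _ => Finset.sum_congr rfl fun k _ => ?_
    by_cases h1 : j < i <;> by_cases h2 : k < i <;> simp [h1, h2]
  rw [Finset.sum_congr rfl h, Finset.sum_comm]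
  refine Finset.sum_congr rfl fun j hj => ?_
  rw [Finset.sum_comm]
  refine Finset.sum_congr rfl fun k hk => ?_
  rw [← Finset.sum_mul, sum_Icc_indicator_lt
    (max_le (Finset.mem_range.1 hj).le (Finset.mem_range.1 hk).le)]
  ring

theorem empiricalCov_eq_sum_bridgeKernel (X Y : ℕ → Ω → ℝ) {n : ℕ} (hn : n ≠ 0) (ω : Ω) :
    empiricalCov X Y n ω =
      ∑ j ∈ Finset.range n, ∑ k ∈ Finset.range n, bridgeKernel n j k * X j ω * Y k ω := by
  have hn' : (n : ℝ) ≠ 0 := by exact_mod_cast hn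
  rw [empiricalCov, sum_walk, sum_walk, sum_walk_mul_walk, mul_assoc, Finset.sum_mul_sum]
  simp only [Finset.mul_sum, ← Finset.sum_sub_distrib]
  refine Finset.sum_congr rfl fun j _ => Finset.sum_congr rfl fun k _ => ?_
  -- The coefficient is `1 - max/n - (1 - j/n)(1 - k/n)`; replacing `max` by `j + k - min` leaves
  -- `min/n - jk/n²`.
  have h : ((min j k : ℕ) : ℝ) + (max j k : ℕ) = j + k := by exact_mod_cast min_add_max j k
  rw [bridgeKernel, show ((max j k : ℕ) : ℝ) = j + k - (min j k : ℕ) by linarith]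
  field_simp
  ring

/-- The Gram matrix of the empirical covariance in the steps `X_2, …, X_{m+1}`; the first step does
not contribute. -/
noncomputable def bridgeMatrix (m : ℕ) : Matrix (Fin m) (Fin m) ℝ :=
  Matrix.of fun j k => bridgeKernel (m + 1) (j + 1) (k + 1)

theorem empiricalCov_eq_dotProduct (X Y : ℕ → Ω → ℝ) (m : ℕ) (ω : Ω) :
    empiricalCov X Y (m + 1) ω = dotProduct (fun j : Fin m => X (j + 1) ω)
      ((bridgeMatrix m).mulVec fun j : Fin m => Y (j + 1) ω) := by
  rw [empiricalCov_eq_sum_bridgeKernel X Y m.succ_ne_zero, Finset.sum_range_succ']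
  have h0 : ∀ k, bridgeKernel (m + 1) 0 k = 0 := fun k => by simp [bridgeKernel]
  have h1 : ∀ k, bridgeKernel (m + 1) k 0 = 0 := fun k => by simp [bridgeKernel]
  simp only [h0, zero_mul, Finset.sum_const_zero, add_zero]
  simp only [dotProduct, Matrix.mulVec, bridgeMatrix, Matrix.of_apply]
  rw [← Fin.sum_univ_eq_sum_range (fun j => ∑ k ∈ Finset.range (m + 1),
    bridgeKernel (m + 1) (j + 1) k * X (j + 1) ω * Y k ω)]
  refine Finset.sum_congr rfl fun j _ => ?_
  rw [Finset.sum_range_succ', h1, Finset.mul_sum, ← Fin.sum_univ_eq_sum_range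
    (fun k => bridgeKernel (m + 1) (j + 1) (k + 1) * X (j + 1) ω * Y (k + 1) ω)]
  simp only [zero_mul, add_zero]
  exact Finset.sum_congr rfl fun k _ => by ring

theorem bridgeMatrix_posSemidef (m : ℕ) : (bridgeMatrix m).PosSemidef := by
  refine Matrix.PosSemidef.of_dotProduct_mulVec_nonneg ?_ fun x => ?_
  · ext j k
    simp [bridgeMatrix, bridgeKernel_comm (m + 1) (k + 1)]
  -- A deterministic walk on a one-point space, with `Z (j + 1) = x j`. Truncated subtraction makes
  -- `Z 0` arbitrary, which is harmless because the first step drops out.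
  · set Z : ℕ → Unit → ℝ := fun k _ => if h : k - 1 < m then x ⟨k - 1, h⟩ else 0
    have h := empiricalCov_self_nonneg Z m.succ_ne_zero ()
    rw [Nat.succ_eq_add_one, empiricalCov_eq_dotProduct] at h
    simpa [Z] using h

end Covariance

/-! ### The determinant of the resolvent -/

section Determinant

/-- The symmetric tridiagonal Toeplitz matrix with `c` on the diagonal and `-1` next to it. -/
def tridiagonal (c : ℝ) (m : ℕ) : Matrix (Fin m) (Fin m) ℝ :=
  Matrix.of fun i j => if (i : ℕ) = j then c else if (i : ℕ) + 1 = j ∨ (j : ℕ) + 1 = i then -1 else 0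

/-- Expansion along the first row, then along the first column of the second minor. -/
theorem det_tridiagonal_add_two (c : ℝ) (m : ℕ) :
    (tridiagonal c (m + 2)).det =
      c * (tridiagonal c (m + 1)).det - (tridiagonal c m).det := by
  rw [Matrix.det_succ_row_zero, Fin.sum_univ_succ, Fin.sum_univ_succ, Finset.sum_eq_zero, add_zero]
  · have h1 : (tridiagonal c (m + 2)).submatrix Fin.succ (Fin.succAbove 0) =
        tridiagonal c (m + 1) := by
      ext i j; simp [tridiagonal]
    have h2 : ((tridiagonal c (m + 2)).submatrix Fin.succ
        (Fin.succAbove (Fin.succ 0))).det = - (tridiagonal c m).det := by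
      rw [Matrix.det_succ_column_zero, Fin.sum_univ_succ, Finset.sum_eq_zero, add_zero]
      · have : ((tridiagonal c (m + 2)).submatrix Fin.succ
            (Fin.succAbove (Fin.succ 0))).submatrix (Fin.succAbove 0) Fin.succ =
            tridiagonal c m := by
          ext i j; simp [tridiagonal]
        rw [this]
        simp [tridiagonal]
      · intro i _
        simp [tridiagonal]
    rw [h1, h2]
    simp [tridiagonal]
    ring
  · intro i _
    simp [tridiagonal]

/-- Both sides satisfy the same two-term recursion, whose characteristic roots are `f` and `f⁻¹`. -/
theorem det_tridiagonal_mul_sub (f : ℝ) (hf : f ≠ 0) : ∀ m : ℕ,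
    (tridiagonal (f + f⁻¹) m).det * (f - f⁻¹) = f ^ (m + 1) - (f ^ (m + 1))⁻¹
  | 0 => by simp
  | 1 => by
    rw [Matrix.det_unique]
    simp [tridiagonal]
    field_simp
    ring
  | m + 2 => by
    have h0 := det_tridiagonal_mul_sub f hf m
    have h1 := det_tridiagonal_mul_sub f hf (m + 1)
    rw [det_tridiagonal_add_two, sub_mul, mul_assoc, h0, h1]
    field_simp
    ring

theorem det_tridiagonal_two : ∀ m : ℕ, (tridiagonal 2 m).det = m + 1
  | 0 => by simp
  | 1 => by
    rw [Matrix.det_unique]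
    simp [tridiagonal]
    norm_num
  | m + 2 => by
    rw [det_tridiagonal_add_two, det_tridiagonal_two m, det_tridiagonal_two (m + 1)]
    push_cast; ring

/-- The matrix acts as a second difference. The zero boundary values of `g` stand in for the
neighbours missing in the first and last columns. -/
theorem sum_mul_tridiagonal (g : ℕ → ℝ) (c : ℝ) {m : ℕ} (h0 : g 0 = 0) (hm : g (m + 1) = 0)
    (j : Fin m) :
    ∑ k : Fin m, g (k + 1) * tridiagonal c m k j = c * g (j + 1) - g j - g (j + 2) := by
  have h : ∀ k : Fin m, g (k + 1) * tridiagonal c m k j =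
      (if (k : ℕ) = j then c * g (k + 1) else 0) - (if (k : ℕ) + 1 = j then g (k + 1) else 0)
        - (if (k : ℕ) = j + 1 then g (k + 1) else 0) := by
    intro k
    simp only [tridiagonal, Matrix.of_apply]
    rcases lt_trichotomy (k : ℕ) j with h | h | h
    · by_cases h' : (k : ℕ) + 1 = j
      · rw [if_neg h.ne, if_pos (Or.inl h'), if_neg h.ne, if_pos h', if_neg (by omega)]; ring
      · rw [if_neg h.ne, if_neg (by omega), if_neg h.ne, if_neg h', if_neg (by omega)]; ring
    · rw [if_pos h, if_pos h, if_neg (by omega), if_neg (by omega)]; ring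
    · by_cases h' : (k : ℕ) = j + 1
      · rw [if_neg h.ne', if_pos (Or.inr h'.symm), if_neg h.ne', if_neg (by omega), if_pos h']; ring
      · rw [if_neg h.ne', if_neg (by omega), if_neg h.ne', if_neg (by omega), if_neg h']; ring
  rw [Finset.sum_congr rfl fun k _ => h k, Fin.sum_univ_eq_sum_range (fun k =>
    (if k = (j : ℕ) then c * g (k + 1) else 0) - (if k + 1 = (j : ℕ) then g (k + 1) else 0)
        - (if k = (j : ℕ) + 1 then g (k + 1) else 0)) m,
    Finset.sum_sub_distrib, Finset.sum_sub_distrib, Finset.sum_ite_eq', Finset.sum_ite_eq',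
    if_pos (Finset.mem_range.2 j.2)]
  congr 1
  · congr 1
    rcases hj : (j : ℕ) with _ | i
    · simp [h0]
    · have := j.2
      simp only [add_left_inj]
      rw [Finset.sum_ite_eq', if_pos (Finset.mem_range.2 (by omega))]
  · split_ifs with h'
    · rfl
    · have : (j : ℕ) + 2 = m + 1 := by
        have := j.2
        simp only [Finset.mem_range] at h'
        omega
      rw [this, hm]

/-- A row of the kernel is piecewise linear in the column index and vanishes at `0` and `m + 1`. Its
second difference is therefore supported at the kink, on the diagonal. -/
theorem bridgeMatrix_mul_tridiagonal_two (m : ℕ) :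
    bridgeMatrix m * tridiagonal 2 m = ((m : ℝ) + 1)⁻¹ • 1 := by
  ext i j
  rw [Matrix.mul_apply]
  simp only [bridgeMatrix, Matrix.of_apply]
  have hm : ((m : ℝ) + 1) ≠ 0 := by positivity
  rw [sum_mul_tridiagonal (fun k => bridgeKernel (m + 1) (i + 1) k) 2 (by simp [bridgeKernel])]
  · simp only [bridgeKernel, Matrix.smul_apply, smul_eq_mul, Matrix.one_apply, Fin.ext_iff]
    rcases lt_trichotomy (i : ℕ) j with h | h | h
    · rw [min_eq_left (by omega), min_eq_left (by omega), min_eq_left (by omega), if_neg h.ne]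
      push_cast; field_simp; ring
    · rw [min_eq_left (by omega), min_eq_right (by omega), min_eq_left (by omega), if_pos h, h]
      push_cast; field_simp; ring
    · rw [min_eq_right (by omega), min_eq_right (by omega), min_eq_right (by omega), if_neg h.ne']
      push_cast; field_simp; ring
  · have := i.2
    rw [bridgeKernel, min_eq_left (by omega)]
    push_cast; field_simp; ring

/-- Multiply by `tridiagonal 2 m`, of determinant `m + 1`: the product is `tridiagonal 2 m` plus `s
/ (m + 1)` times the identity. -/
theorem det_one_add_smul_bridgeMatrix (m : ℕ) (s : ℝ) :
    (1 + s • bridgeMatrix m).det * (m + 1) = (tridiagonal (s / (m + 1) + 2) m).det := by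
  conv_lhs => rw [← det_tridiagonal_two, ← Matrix.det_mul, add_mul, one_mul, Matrix.smul_mul,
    bridgeMatrix_mul_tridiagonal_two]
  congr 1
  ext i j
  simp only [tridiagonal, Matrix.add_apply, Matrix.of_apply, Matrix.smul_apply, Matrix.one_apply,
    smul_eq_mul, Fin.ext_iff]
  split_ifs <;> ring

theorem fRoot_pos {l : ℝ} (hl : 0 < l) : 0 < fRoot l := by
  unfold fRoot; positivity

/-- `fRoot l` and the claimed inverse are the two roots of `z² - (l + 2) z + 1`, whose product is
`1`. -/
theorem inv_fRoot {l : ℝ} (hl : 0 < l) : (fRoot l)⁻¹ = ((l + 2) - √((l + 2) ^ 2 - 4)) / 2 := by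
  have h : √((l + 2) ^ 2 - 4) ^ 2 = (l + 2) ^ 2 - 4 := Real.sq_sqrt (by nlinarith)
  refine inv_eq_of_mul_eq_one_right ?_
  unfold fRoot
  linear_combination (-1 / 4) * h

theorem fRoot_add_inv {l : ℝ} (hl : 0 < l) : fRoot l + (fRoot l)⁻¹ = l + 2 := by
  rw [inv_fRoot hl, fRoot]; ring

theorem fRoot_sub_inv {l : ℝ} (hl : 0 < l) : fRoot l - (fRoot l)⁻¹ = √((l + 2) ^ 2 - 4) := by
  rw [inv_fRoot hl, fRoot]; ring

theorem sqrt_div_add_two_sq_sub_four {n : ℝ} (hn : 0 < n) (s : ℝ) :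
    √((s / n + 2) ^ 2 - 4) = √(s ^ 2 + 4 * n * s) / n := by
  rw [show (s / n + 2) ^ 2 - 4 = (s ^ 2 + 4 * n * s) / n ^ 2 by field_simp; ring,
    Real.sqrt_div' _ (by positivity), Real.sqrt_sq hn.le]

theorem det_one_add_smul_bridgeMatrix_mul_sqrt (m : ℕ) {s : ℝ} (hs : 0 < s) :
    (1 + s • bridgeMatrix m).det * √(s ^ 2 + 4 * (m + 1 : ℕ) * s) = fDiff (m + 1) s := by
  have hn : (0 : ℝ) < (m + 1 : ℕ) := by positivity
  have hl : 0 < s / (m + 1 : ℕ) := by positivity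
  have h := det_tridiagonal_mul_sub _ (fRoot_pos hl).ne' m
  rw [fRoot_add_inv hl, fRoot_sub_inv hl, sqrt_div_add_two_sq_sub_four hn] at h
  have h' := det_one_add_smul_bridgeMatrix m s
  push_cast at h h'
  rw [← h'] at h
  rw [fDiff, zpow_neg, zpow_natCast]
  push_cast
  rw [← h]
  field_simp

end Determinant

/-! ### Gaussian integrals against an exponential weight -/

section GaussianWeight

open scoped NNReal

/-- The weight only changes the variance from `1` to `1 / (1 + q)`; the prefactor is the ratio of
normalizing constants. -/
theorem integral_mul_exp_neg_sq_gaussianReal (g : ℝ → ℝ) {q : ℝ} (hq : 0 ≤ q) :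
    ∫ x, g x * Real.exp (-(q * x ^ 2) / 2) ∂(gaussianReal 0 1) =
      (√(1 + q))⁻¹ * ∫ x, g x ∂(gaussianReal 0 (1 + q)⁻¹.toNNReal) := by
  have hq' : 0 < 1 + q := by positivity
  have hv : ((1 + q)⁻¹.toNNReal : ℝ) = (1 + q)⁻¹ := Real.coe_toNNReal _ (by positivity)
  rw [integral_gaussianReal_eq_integral_smul one_ne_zero,
    integral_gaussianReal_eq_integral_smul (by simpa using hq'), ← integral_const_mul]
  congr 1
  ext x
  simp only [gaussianPDFReal, hv, smul_eq_mul, NNReal.coe_one, sub_zero]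
  have h1 : (√(2 * Real.pi * (1 + q)⁻¹))⁻¹ = √(1 + q) * (√(2 * Real.pi * 1))⁻¹ := by
    rw [Real.sqrt_mul (by positivity), Real.sqrt_inv, mul_inv, inv_inv, mul_one, mul_comm]
  have h2 : Real.exp (-x ^ 2 / (2 * (1 + q)⁻¹)) =
      Real.exp (-x ^ 2 / (2 * 1)) * Real.exp (-(q * x ^ 2) / 2) := by
    rw [← Real.exp_add]; congr 1; field_simp; ring
  rw [h1, h2]
  have : √(1 + q) ≠ 0 := by positivity
  field_simp

theorem integral_exp_neg_sq_gaussianReal {q : ℝ} (hq : 0 ≤ q) :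
    ∫ x, Real.exp (-(q * x ^ 2) / 2) ∂(gaussianReal 0 1) = (√(1 + q))⁻¹ := by
  simpa using integral_mul_exp_neg_sq_gaussianReal (fun _ => 1) hq

theorem integral_id_mul_exp_neg_sq_gaussianReal {q : ℝ} (hq : 0 ≤ q) :
    ∫ x, x * Real.exp (-(q * x ^ 2) / 2) ∂(gaussianReal 0 1) = 0 := by
  simpa using integral_mul_exp_neg_sq_gaussianReal (fun x => x) hq

theorem integral_sq_mul_exp_neg_sq_gaussianReal {q : ℝ} (hq : 0 ≤ q) :
    ∫ x, x ^ 2 * Real.exp (-(q * x ^ 2) / 2) ∂(gaussianReal 0 1) =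
      (√(1 + q))⁻¹ * (1 + q)⁻¹ := by
  rw [integral_mul_exp_neg_sq_gaussianReal (fun x => x ^ 2) hq]
  have h := variance_fun_id_gaussianReal (μ := 0) (v := (1 + q)⁻¹.toNNReal)
  rw [variance_of_integral_eq_zero aemeasurable_id' integral_id_gaussianReal,
    Real.coe_toNNReal _ (by positivity)] at h
  rw [h]

theorem integrable_pow_mul_exp_neg_sq_gaussianReal (k : ℕ) {q : ℝ} (hq : 0 ≤ q) :
    Integrable (fun x => x ^ k * Real.exp (-(q * x ^ 2) / 2)) (gaussianReal 0 1) := by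
  have h : Integrable (fun x : ℝ => x ^ k) (gaussianReal 0 1) := by
    rcases Nat.eq_zero_or_pos k with rfl | hk
    · simp
    · have h1 := (memLp_id_gaussianReal (μ := 0) (v := 1) (k : ℝ≥0)).integrable_norm_pow'
      refine (integrable_norm_iff (by fun_prop)).1 ?_
      simpa using h1
  refine h.mono (by fun_prop) (Filter.Eventually.of_forall fun x => ?_)
  rw [norm_mul, Real.norm_of_nonneg (Real.exp_pos _).le]
  refine mul_le_of_le_one_right (norm_nonneg _) (Real.exp_le_one_iff.2 ?_)
  have : 0 ≤ q * x ^ 2 := by positivity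
  linarith

end GaussianWeight

/-! ### The expected squared correlation for a diagonal quadratic form -/

section Diagonal

variable {ι : Type*} [Fintype ι]

/-- The determinant of `1 + s * diag κ`. -/
noncomputable def diagDet (κ : ι → ℝ) (s : ℝ) : ℝ := ∏ i, (1 + s * κ i)

theorem diagDet_pos {κ : ι → ℝ} (hκ : ∀ i, 0 ≤ κ i) {s : ℝ} (hs : 0 ≤ s) : 0 < diagDet κ s :=
  Finset.prod_pos fun i _ => by have := mul_nonneg hs (hκ i); linarith

/-- The density obtained by integrating out the Gaussian variables. -/
noncomputable def diagDensity (κ : ι → ℝ) (s t : ℝ) : ℝ :=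
  (√(diagDet κ s))⁻¹ * (√(diagDet κ t))⁻¹ * ∑ i, κ i ^ 2 / ((1 + s * κ i) * (1 + t * κ i))

theorem diagDensity_nonneg {κ : ι → ℝ} (hκ : ∀ i, 0 ≤ κ i) {s t : ℝ} (hs : 0 ≤ s) (ht : 0 ≤ t) :
    0 ≤ diagDensity κ s t := by
  refine mul_nonneg (by positivity) (Finset.sum_nonneg fun i _ => ?_)
  have := mul_nonneg hs (hκ i)
  have := mul_nonneg ht (hκ i)
  positivity

theorem measurable_diagDensity (κ : ι → ℝ) :
    Measurable fun p : ℝ × ℝ => diagDensity κ p.1 p.2 := by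
  unfold diagDensity diagDet; fun_prop

/-- The added indicators give exponent `2` when `k = l`, so both cases factor over coordinates. -/
theorem mul_exp_neg_sum_sq_eq_prod [DecidableEq ι] (q : ι → ℝ) (k l : ι) (x : ι → ℝ) :
    x k * x l * Real.exp (-(∑ i, q i * x i ^ 2) / 2) =
      ∏ i, (x i ^ ((if i = k then 1 else 0) + if i = l then 1 else 0) *
        Real.exp (-(q i * x i ^ 2) / 2)) := by
  rw [Finset.prod_mul_distrib, ← Real.exp_sum]
  congr 1
  · simp only [pow_add, Finset.prod_mul_distrib, pow_ite, pow_one, pow_zero, Finset.prod_ite_eq',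
      Finset.mem_univ, if_true]
  · rw [← Finset.sum_div, Finset.sum_neg_distrib]

theorem integrable_mul_exp_neg_sum_sq {q : ι → ℝ} (hq : ∀ i, 0 ≤ q i) (k l : ι) :
    Integrable (fun x : ι → ℝ => x k * x l * Real.exp (-(∑ i, q i * x i ^ 2) / 2))
      (Measure.pi fun _ => gaussianReal 0 1) := by
  classical
  simp only [mul_exp_neg_sum_sq_eq_prod q k l]
  exact Integrable.fintype_prod (f := fun i (y : ℝ) =>
    y ^ ((if i = k then 1 else 0) + if i = l then 1 else 0) * Real.exp (-(q i * y ^ 2) / 2))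
    fun i => integrable_pow_mul_exp_neg_sq_gaussianReal _ (hq i)

/-- For `k ≠ l` the factor at coordinate `k` is the integral of an odd function, so only diagonal
terms survive. -/
theorem integral_mul_exp_neg_sum_sq [DecidableEq ι] {q : ι → ℝ} (hq : ∀ i, 0 ≤ q i) (k l : ι) :
    ∫ x : ι → ℝ, x k * x l * Real.exp (-(∑ i, q i * x i ^ 2) / 2)
      ∂(Measure.pi fun _ => gaussianReal 0 1) =
      if k = l then (√(∏ i, (1 + q i)))⁻¹ * (1 + q k)⁻¹ else 0 := by
  simp only [mul_exp_neg_sum_sq_eq_prod q k l]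
  rw [integral_fintype_prod_eq_prod (f := fun i (y : ℝ) =>
    y ^ ((if i = k then 1 else 0) + if i = l then 1 else 0) * Real.exp (-(q i * y ^ 2) / 2))]
  split_ifs with h
  · subst h
    have h1 : ∀ i, ∫ y : ℝ, y ^ ((if i = k then 1 else 0) + if i = k then 1 else 0) *
        Real.exp (-(q i * y ^ 2) / 2) ∂(gaussianReal 0 1) =
        (√(1 + q i))⁻¹ * if i = k then (1 + q i)⁻¹ else 1 := by
      intro i
      split_ifs with hi
      · exact integral_sq_mul_exp_neg_sq_gaussianReal (hq i)
      · simpa using integral_exp_neg_sq_gaussianReal (hq i)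
    simp only [h1]
    rw [Finset.prod_mul_distrib, Finset.prod_ite_eq' Finset.univ k, if_pos (Finset.mem_univ _),
      Real.sqrt_eq_rpow, ← Real.finsetProd_rpow _ _ fun i _ => by have := hq i; positivity,
      Finset.prod_inv_distrib]
    simp only [Real.sqrt_eq_rpow]
  · refine Finset.prod_eq_zero (Finset.mem_univ k) ?_
    simpa [h] using integral_id_mul_exp_neg_sq_gaussianReal (hq k)

theorem sq_sum_mul_exp_eq (κ : ι → ℝ) (s t : ℝ) (x y : ι → ℝ) :
    (∑ i, κ i * x i * y i) ^ 2 *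
        Real.exp (-(s * (∑ i, κ i * x i ^ 2) + t * ∑ i, κ i * y i ^ 2) / 2) =
      ∑ k, ∑ l, κ k * κ l * ((x k * x l * Real.exp (-(∑ i, s * κ i * x i ^ 2) / 2)) *
        (y k * y l * Real.exp (-(∑ i, t * κ i * y i ^ 2) / 2))) := by
  have : Real.exp (-(s * (∑ i, κ i * x i ^ 2) + t * ∑ i, κ i * y i ^ 2) / 2) =
      Real.exp (-(∑ i, s * κ i * x i ^ 2) / 2) * Real.exp (-(∑ i, t * κ i * y i ^ 2) / 2) := by
    rw [← Real.exp_add]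
    simp only [mul_assoc, ← Finset.mul_sum]
    congr 1; ring
  rw [this, sq, Finset.sum_mul_sum, Finset.sum_mul]
  refine Finset.sum_congr rfl fun k _ => ?_
  rw [Finset.sum_mul]
  exact Finset.sum_congr rfl fun l _ => by ring

theorem integrable_sq_sum_mul_exp {κ : ι → ℝ} (hκ : ∀ i, 0 ≤ κ i) {s t : ℝ} (hs : 0 ≤ s)
    (ht : 0 ≤ t) :
    Integrable (fun p : (ι → ℝ) × (ι → ℝ) => (∑ i, κ i * p.1 i * p.2 i) ^ 2 *
        Real.exp (-(s * (∑ i, κ i * p.1 i ^ 2) + t * ∑ i, κ i * p.2 i ^ 2) / 2))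
      ((Measure.pi fun _ => gaussianReal 0 1).prod (Measure.pi fun _ => gaussianReal 0 1)) := by
  simp only [sq_sum_mul_exp_eq]
  refine integrable_finsetSum _ fun k _ => integrable_finsetSum _ fun l _ => Integrable.const_mul ?_ _
  exact (integrable_mul_exp_neg_sum_sq (fun i => mul_nonneg hs (hκ i)) k l).mul_prod
    (integrable_mul_exp_neg_sum_sq (fun i => mul_nonneg ht (hκ i)) k l)

theorem integral_sq_sum_mul_exp {κ : ι → ℝ} (hκ : ∀ i, 0 ≤ κ i) {s t : ℝ} (hs : 0 ≤ s)
    (ht : 0 ≤ t) :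
    ∫ p : (ι → ℝ) × (ι → ℝ), (∑ i, κ i * p.1 i * p.2 i) ^ 2 *
        Real.exp (-(s * (∑ i, κ i * p.1 i ^ 2) + t * ∑ i, κ i * p.2 i ^ 2) / 2)
      ∂((Measure.pi fun _ => gaussianReal 0 1).prod (Measure.pi fun _ => gaussianReal 0 1)) =
      diagDensity κ s t := by
  classical
  have hs' : ∀ i, 0 ≤ s * κ i := fun i => mul_nonneg hs (hκ i)
  have ht' : ∀ i, 0 ≤ t * κ i := fun i => mul_nonneg ht (hκ i)
  have hI : ∀ k l, Integrable (fun p : (ι → ℝ) × (ι → ℝ) => κ k * κ l *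
      ((p.1 k * p.1 l * Real.exp (-(∑ i, s * κ i * p.1 i ^ 2) / 2)) *
        (p.2 k * p.2 l * Real.exp (-(∑ i, t * κ i * p.2 i ^ 2) / 2))))
      ((Measure.pi fun _ => gaussianReal 0 1).prod (Measure.pi fun _ => gaussianReal 0 1)) :=
    fun k l => ((integrable_mul_exp_neg_sum_sq hs' k l).mul_prod
      (integrable_mul_exp_neg_sum_sq ht' k l)).const_mul _
  simp only [sq_sum_mul_exp_eq]
  rw [integral_finsetSum _ fun k _ => integrable_finsetSum _ fun l _ => hI k l, diagDensity,
    Finset.mul_sum]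
  refine Finset.sum_congr rfl fun k _ => ?_
  rw [integral_finsetSum _ fun l _ => hI k l]
  have : ∀ l, ∫ p : (ι → ℝ) × (ι → ℝ), κ k * κ l *
      ((p.1 k * p.1 l * Real.exp (-(∑ i, s * κ i * p.1 i ^ 2) / 2)) *
        (p.2 k * p.2 l * Real.exp (-(∑ i, t * κ i * p.2 i ^ 2) / 2)))
      ∂((Measure.pi fun _ => gaussianReal 0 1).prod (Measure.pi fun _ => gaussianReal 0 1)) =
      if k = l then κ k ^ 2 * ((√(diagDet κ s))⁻¹ * (1 + s * κ k)⁻¹ *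
        ((√(diagDet κ t))⁻¹ * (1 + t * κ k)⁻¹)) else 0 := by
    intro l
    rw [integral_const_mul, integral_prod_mul
      (f := fun x : ι → ℝ => x k * x l * Real.exp (-(∑ i, s * κ i * x i ^ 2) / 2))
      (g := fun x : ι → ℝ => x k * x l * Real.exp (-(∑ i, t * κ i * x i ^ 2) / 2)),
      integral_mul_exp_neg_sum_sq hs', integral_mul_exp_neg_sum_sq ht']
    split_ifs with h
    · subst h; rw [diagDet, diagDet, sq]
    · simp
  simp only [this]
  rw [Finset.sum_ite_eq, if_pos (Finset.mem_univ _), div_eq_mul_inv, mul_inv]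
  ring

theorem sq_sum_mul_le {κ : ι → ℝ} (hκ : ∀ i, 0 ≤ κ i) (x y : ι → ℝ) :
    (∑ i, κ i * x i * y i) ^ 2 ≤ (∑ i, κ i * x i ^ 2) * ∑ i, κ i * y i ^ 2 := by
  have h := Finset.sum_mul_sq_le_sq_mul_sq Finset.univ (fun i => √(κ i) * x i)
    (fun i => √(κ i) * y i)
  have e : ∀ i, √(κ i) * √(κ i) = κ i := fun i => Real.mul_self_sqrt (hκ i)
  calc _ = (∑ i, √(κ i) * x i * (√(κ i) * y i)) ^ 2 := by
        congr 1
        exact Finset.sum_congr rfl fun i _ => by linear_combination (-(x i * y i)) * e i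
    _ ≤ _ := h
    _ = _ := by simp only [mul_pow, Real.sq_sqrt (hκ _)]

/-- The correlation coefficient of `x` and `y` for the quadratic form `diag κ`. -/
noncomputable def diagCorr (κ : ι → ℝ) (x y : ι → ℝ) : ℝ :=
  (∑ i, κ i * x i * y i) / (√(∑ i, κ i * x i ^ 2) * √(∑ i, κ i * y i ^ 2))

theorem diagCorr_sq {κ : ι → ℝ} (hκ : ∀ i, 0 ≤ κ i) (x y : ι → ℝ) :
    diagCorr κ x y ^ 2 =
      (∑ i, κ i * x i * y i) ^ 2 / ((∑ i, κ i * x i ^ 2) * ∑ i, κ i * y i ^ 2) := by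
  have h : ∀ x : ι → ℝ, 0 ≤ ∑ i, κ i * x i ^ 2 :=
    fun x => Finset.sum_nonneg fun i _ => mul_nonneg (hκ i) (sq_nonneg _)
  rw [diagCorr, div_pow, mul_pow, Real.sq_sqrt (h x), Real.sq_sqrt (h y)]

theorem diagCorr_sq_le_one {κ : ι → ℝ} (hκ : ∀ i, 0 ≤ κ i) (x y : ι → ℝ) :
    diagCorr κ x y ^ 2 ≤ 1 := by
  rw [diagCorr_sq hκ]
  exact div_le_one_of_le₀ (sq_sum_mul_le hκ x y)
    (mul_nonneg (Finset.sum_nonneg fun i _ => mul_nonneg (hκ i) (sq_nonneg _))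
      (Finset.sum_nonneg fun i _ => mul_nonneg (hκ i) (sq_nonneg _)))

theorem measurable_diagCorr (κ : ι → ℝ) :
    Measurable fun p : (ι → ℝ) × (ι → ℝ) => diagCorr κ p.1 p.2 := by
  unfold diagCorr; fun_prop

theorem lintegral_exp_neg_mul_half {a : ℝ} (ha : 0 < a) :
    ∫⁻ s in Ioi (0 : ℝ), ENNReal.ofReal (Real.exp (-(s * a) / 2)) = ENNReal.ofReal (2 / a) := by
  have h : ∀ s : ℝ, Real.exp (-(s * a) / 2) = Real.exp (-(a / 2) * s) := fun s => by
    congr 1; ring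
  simp only [h]
  rw [← ofReal_integral_eq_lintegral_ofReal (integrableOn_exp_mul_Ioi (by linarith) 0)
    (Filter.Eventually.of_forall fun s => (Real.exp_pos _).le),
    integral_exp_mul_Ioi (by linarith)]
  congr 1
  simp

/-- Each variable integrates to `2 / a` or `2 / b`. The Cauchy–Schwarz bound `hc` forces `c = 0`
when `a` or `b` vanishes, and then both sides are `0`. -/
theorem lintegral_sq_mul_exp {a b c : ℝ} (ha : 0 ≤ a) (hb : 0 ≤ b) (hc : c ^ 2 ≤ a * b) :
    ∫⁻ q in Ioi (0 : ℝ) ×ˢ Ioi (0 : ℝ),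
      ENNReal.ofReal (c ^ 2 * Real.exp (-(q.1 * a + q.2 * b) / 2)) =
      ENNReal.ofReal (4 * (c ^ 2 / (a * b))) := by
  rcases eq_or_ne c 0 with rfl | hc0
  · simp
  have hab : 0 < a * b := lt_of_lt_of_le (by positivity) hc
  have ha' : 0 < a := lt_of_le_of_ne ha fun h => by simp [← h] at hab
  have hb' : 0 < b := lt_of_le_of_ne hb fun h => by simp [← h] at hab
  have h : ∀ q : ℝ × ℝ, ENNReal.ofReal (c ^ 2 * Real.exp (-(q.1 * a + q.2 * b) / 2)) =
      ENNReal.ofReal (c ^ 2) * (ENNReal.ofReal (Real.exp (-(q.1 * a) / 2)) *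
        ENNReal.ofReal (Real.exp (-(q.2 * b) / 2))) := by
    intro q
    rw [← ENNReal.ofReal_mul (Real.exp_pos _).le, ← ENNReal.ofReal_mul (by positivity),
      ← Real.exp_add]
    congr 3; ring
  simp only [h]
  rw [lintegral_const_mul _ (by fun_prop), Measure.volume_eq_prod, ← Measure.prod_restrict,
    lintegral_prod_mul (f := fun s => ENNReal.ofReal (Real.exp (-(s * a) / 2)))
      (g := fun s => ENNReal.ofReal (Real.exp (-(s * b) / 2))) (by fun_prop) (by fun_prop),
    lintegral_exp_neg_mul_half ha', lintegral_exp_neg_mul_half hb',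
    ← ENNReal.ofReal_mul (by positivity), ← ENNReal.ofReal_mul (by positivity)]
  congr 1
  field_simp
  ring

/-- Tonelli: integrating the Gaussian variables first gives the density, integrating `s, t` first
gives the correlation. Working in `ENNReal` needs no prior integrability, which then follows from
the bound `diagCorr ^ 2 ≤ 1`. -/
theorem lintegral_diagDensity {κ : ι → ℝ} (hκ : ∀ i, 0 ≤ κ i) :
    ∫⁻ q in Ioi (0 : ℝ) ×ˢ Ioi (0 : ℝ), ENNReal.ofReal (diagDensity κ q.1 q.2) =
      ∫⁻ p, ENNReal.ofReal (4 * diagCorr κ p.1 p.2 ^ 2)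
        ∂((Measure.pi fun _ : ι => gaussianReal 0 1).prod
          (Measure.pi fun _ : ι => gaussianReal 0 1)) := by
  have h0 : ∀ x : ι → ℝ, 0 ≤ ∑ i, κ i * x i ^ 2 :=
    fun x => Finset.sum_nonneg fun i _ => mul_nonneg (hκ i) (sq_nonneg _)
  have h1 : ∀ q ∈ Ioi (0 : ℝ) ×ˢ Ioi (0 : ℝ), ENNReal.ofReal (diagDensity κ q.1 q.2) =
      ∫⁻ p : (ι → ℝ) × (ι → ℝ), ENNReal.ofReal ((∑ i, κ i * p.1 i * p.2 i) ^ 2 *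
        Real.exp (-(q.1 * (∑ i, κ i * p.1 i ^ 2) + q.2 * ∑ i, κ i * p.2 i ^ 2) / 2))
        ∂((Measure.pi fun _ => gaussianReal 0 1).prod (Measure.pi fun _ => gaussianReal 0 1)) := by
    intro q hq
    have hs : 0 ≤ q.1 := (mem_Ioi.1 hq.1).le
    have ht : 0 ≤ q.2 := (mem_Ioi.1 hq.2).le
    rw [← integral_sq_sum_mul_exp hκ hs ht,
      ofReal_integral_eq_lintegral_ofReal (integrable_sq_sum_mul_exp hκ hs ht)
        (Filter.Eventually.of_forall fun p => by positivity)]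
  rw [setLIntegral_congr_fun (measurableSet_Ioi.prod measurableSet_Ioi) h1,
    lintegral_lintegral_swap]
  · refine lintegral_congr fun p => ?_
    rw [diagCorr_sq hκ, lintegral_sq_mul_exp (h0 _) (h0 _) (sq_sum_mul_le hκ _ _)]
  · exact Measurable.aemeasurable (by fun_prop)

theorem integrableOn_diagDensity {κ : ι → ℝ} (hκ : ∀ i, 0 ≤ κ i) :
    IntegrableOn (fun q : ℝ × ℝ => diagDensity κ q.1 q.2) (Ioi 0 ×ˢ Ioi 0) := by
  refine (lintegral_ofReal_ne_top_iff_integrable (measurable_diagDensity κ).aestronglyMeasurable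
    ?_).1 ?_
  · filter_upwards [ae_restrict_mem (measurableSet_Ioi.prod measurableSet_Ioi)] with q hq
    exact diagDensity_nonneg hκ (mem_Ioi.1 hq.1).le (mem_Ioi.1 hq.2).le
  · rw [lintegral_diagDensity hκ]
    have h4 : ∀ p : (ι → ℝ) × (ι → ℝ), ENNReal.ofReal (4 * diagCorr κ p.1 p.2 ^ 2) ≤
        ENNReal.ofReal 4 := fun p => ENNReal.ofReal_le_ofReal (by
      have := diagCorr_sq_le_one hκ p.1 p.2
      linarith)
    refine ((lintegral_mono h4).trans_lt ?_).ne
    simp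

theorem integral_diagCorr_sq {κ : ι → ℝ} (hκ : ∀ i, 0 ≤ κ i) :
    ∫ p, diagCorr κ p.1 p.2 ^ 2 ∂((Measure.pi fun _ : ι => gaussianReal 0 1).prod
          (Measure.pi fun _ : ι => gaussianReal 0 1)) =
      1 / 4 * ∫ q in Ioi (0 : ℝ) ×ˢ Ioi (0 : ℝ), diagDensity κ q.1 q.2 := by
  have h : ∫ q in Ioi (0 : ℝ) ×ˢ Ioi (0 : ℝ), diagDensity κ q.1 q.2 =
      ∫ p, 4 * diagCorr κ p.1 p.2 ^ 2 ∂((Measure.pi fun _ : ι => gaussianReal 0 1).prod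
          (Measure.pi fun _ : ι => gaussianReal 0 1)) := by
    rw [integral_eq_lintegral_of_nonneg_ae _ (measurable_diagDensity κ).aestronglyMeasurable,
      integral_eq_lintegral_of_nonneg_ae _
        (((measurable_diagCorr κ).pow_const 2).const_mul 4).aestronglyMeasurable,
      lintegral_diagDensity hκ]
    · exact Filter.Eventually.of_forall fun p => by positivity
    · filter_upwards [ae_restrict_mem (measurableSet_Ioi.prod measurableSet_Ioi)] with q hq
      exact diagDensity_nonneg hκ (mem_Ioi.1 hq.1).le (mem_Ioi.1 hq.2).le
  rw [h, integral_const_mul]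
  ring

end Diagonal

/-! ### The closed form of the density -/

section ClosedForm

theorem fRoot_div_eq {n : ℕ} (hn : n ≠ 0) (s : ℝ) :
    fRoot (s / n) = (s + 2 * n + √(s ^ 2 + 4 * n * s)) / (2 * n) := by
  have hn' : (0 : ℝ) < n := by positivity
  rw [fRoot, sqrt_div_add_two_sq_sub_four hn']
  field_simp

theorem hasDerivAt_sqrt_sq_add {n : ℕ} {s : ℝ} (hs : 0 < s) :
    HasDerivAt (fun s : ℝ => √(s ^ 2 + 4 * n * s)) ((s + 2 * n) / √(s ^ 2 + 4 * n * s)) s := by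
  have h : HasDerivAt (fun s : ℝ => s ^ 2 + 4 * n * s) (2 * s + 4 * n) s := by
    simpa using (hasDerivAt_pow 2 s).fun_add ((hasDerivAt_id s).const_mul (4 * (n : ℝ)))
  have h' := h.sqrt (by positivity)
  convert h' using 1
  have : 0 < √(s ^ 2 + 4 * n * s) := by positivity
  field_simp
  ring

/-- With `u = s + 2n` and `R = √(s² + 4ns)`, the numerator `u + R` has derivative `1 + u / R = (u +
R) / R`. -/
theorem hasDerivAt_fRoot_div {n : ℕ} (hn : n ≠ 0) {s : ℝ} (hs : 0 < s) :
    HasDerivAt (fun s : ℝ => fRoot (s / n)) (fRoot (s / n) / √(s ^ 2 + 4 * n * s)) s := by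
  have hn' : (0 : ℝ) < n := by positivity
  simp only [fRoot_div_eq hn]
  have h := ((((hasDerivAt_id s).add_const (2 * (n : ℝ))).add
    (hasDerivAt_sqrt_sq_add (n := n) hs))).div_const (2 * (n : ℝ))
  refine h.congr_deriv ?_
  have : 0 < √(s ^ 2 + 4 * n * s) := by positivity
  field_simp
  ring

theorem fDiff_eq (n : ℕ) (s : ℝ) :
    fDiff n s = fRoot (s / n) ^ n - (fRoot (s / n) ^ n)⁻¹ := by
  rw [fDiff, zpow_neg, zpow_natCast]

theorem hasDerivAt_fDiff {n : ℕ} (hn : n ≠ 0) {s : ℝ} (hs : 0 < s) :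
    HasDerivAt (fDiff n)
      (n * (fRoot (s / n) ^ n + (fRoot (s / n) ^ n)⁻¹) / √(s ^ 2 + 4 * n * s)) s := by
  have hn' : (0 : ℝ) < n := by positivity
  have hf : 0 < fRoot (s / n) := fRoot_pos (by positivity)
  have hR : 0 < √(s ^ 2 + 4 * n * s) := by positivity
  have h1 := (hasDerivAt_fRoot_div hn hs).fun_pow n
  have h2 := h1.fun_sub (h1.fun_inv (by positivity))
  rw [show fDiff n = fun s => fRoot (s / n) ^ n - (fRoot (s / n) ^ n)⁻¹ from
    funext fun s => fDiff_eq n s]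
  refine h2.congr_deriv ?_
  obtain ⟨k, rfl⟩ := Nat.exists_eq_succ_of_ne_zero hn
  simp only [Nat.succ_eq_add_one, Nat.add_sub_cancel]
  field_simp
  ring

variable {ι : Type*} [Fintype ι]

/-- Both sides are the logarithmic derivative of `diagDet κ`, computed from the product and from its
closed form. -/
theorem sum_div_one_add_eq {κ : ι → ℝ} (hκ : ∀ i, 0 ≤ κ i) {n : ℕ} (hn : n ≠ 0)
    (hdet : ∀ s : ℝ, 0 < s → diagDet κ s * √(s ^ 2 + 4 * n * s) = fDiff n s) {s : ℝ}
    (hs : 0 < s) :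
    ∑ i, κ i / (1 + s * κ i) =
      n * (fRoot (s / n) ^ n + (fRoot (s / n) ^ n)⁻¹) / (√(s ^ 2 + 4 * n * s) * fDiff n s) -
        (s + 2 * n) / √(s ^ 2 + 4 * n * s) ^ 2 := by
  have hR : ∀ {s : ℝ}, 0 < s → 0 < √(s ^ 2 + 4 * n * s) := fun hs => by positivity
  have hP : 0 < fDiff n s := by rw [← hdet s hs]; exact mul_pos (diagDet_pos hκ hs.le) (hR hs)
  have hκs : ∀ {s : ℝ}, 0 < s → ∀ i, 0 < 1 + s * κ i := fun hs i => by
    have := mul_nonneg hs.le (hκ i); linarith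
  have h1 : HasDerivAt (fun s => ∑ i, Real.log (1 + s * κ i)) (∑ i, κ i / (1 + s * κ i)) s := by
    refine HasDerivAt.fun_sum fun i _ => ?_
    have := ((hasDerivAt_id s).mul_const (κ i)).const_add 1
    simpa using this.log (hκs hs i).ne'
  have h2 := ((hasDerivAt_fDiff hn hs).log hP.ne').sub
    ((hasDerivAt_sqrt_sq_add (n := n) hs).log (hR hs).ne')
  have he : (fun s => ∑ i, Real.log (1 + s * κ i)) =ᶠ[nhds s]
      (fun s => Real.log (fDiff n s)) - fun s => Real.log √(s ^ 2 + 4 * n * s) := by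
    filter_upwards [lt_mem_nhds hs] with r hr
    rw [Pi.sub_apply, ← hdet r hr, Real.log_mul (diagDet_pos hκ hr.le).ne' (hR hr).ne', diagDet,
      Real.log_prod fun i _ => (hκs hr i).ne']
    ring
  have h3 := h1.unique (h2.congr_of_eventuallyEq he)
  rw [h3, div_div, div_div, sq √(s ^ 2 + 4 * n * s)]

theorem sum_sq_div_eq {κ : ι → ℝ} (hκ : ∀ i, 0 ≤ κ i) {s t : ℝ} (hs : 0 < s) (ht : 0 < t)
    (hst : s ≠ t) :
    ∑ i, κ i ^ 2 / ((1 + s * κ i) * (1 + t * κ i)) =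
      (∑ i, κ i / (1 + t * κ i) - ∑ i, κ i / (1 + s * κ i)) / (s - t) := by
  rw [← Finset.sum_sub_distrib, Finset.sum_div]
  refine Finset.sum_congr rfl fun i _ => ?_
  have h1 : 1 + s * κ i ≠ 0 := by have := mul_nonneg hs.le (hκ i); positivity
  have h2 : 1 + t * κ i ≠ 0 := by have := mul_nonneg ht.le (hκ i); positivity
  have h3 : s - t ≠ 0 := sub_ne_zero.2 hst
  rw [div_sub_div _ _ h2 h1, div_div, div_eq_div_iff (mul_ne_zero h1 h2)
    (mul_ne_zero (mul_ne_zero h2 h1) h3)]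
  ring

/-- The right side expands as `n / (s - t)` times `(R - V)(FG - F⁻¹G⁻¹) + (R + V)(FG⁻¹ - GF⁻¹)`. The
identity `R² - V² = (s - t)(s + t + 4n)` and the resulting formula for `f - g` remove `s - t` from
the denominators, which gives the form used in `integrandB`. -/
theorem bracket_eq {n s t R V f g F G : ℝ} (hn : 0 < n) (hs : 0 < s) (ht : 0 < t) (hst : s ≠ t)
    (hR : 0 < R) (hV : 0 < V) (hF : 0 < F) (hG : 0 < G)
    (hR2 : R ^ 2 = s ^ 2 + 4 * n * s) (hV2 : V ^ 2 = t ^ 2 + 4 * n * t)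
    (hf : f = (s + 2 * n + R) / (2 * n)) (hg : g = (t + 2 * n + V) / (2 * n)) :
    n * (s + t + 4 * n) / (R + V) * (F * G - F⁻¹ * G⁻¹) +
      1 / 2 * (R + V + s + t + 4 * n) * ((F * G⁻¹ - G * F⁻¹) / (f - g)) =
    n * ((G + G⁻¹) * (F - F⁻¹) * R - (F + F⁻¹) * (G - G⁻¹) * V) / (s - t) := by
  have h3 : s - t ≠ 0 := sub_ne_zero.2 hst
  have h1 : (s + t + 4 * n) / (R + V) = (R - V) / (s - t) := by
    rw [div_eq_div_iff (by positivity) h3]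
    linear_combination hV2 - hR2
  have h2 : f - g = (s - t) * (R + V + s + t + 4 * n) / (2 * n * (R + V)) := by
    rw [hf, hg, ← sub_div, div_eq_div_iff (by positivity) (by positivity)]
    linear_combination 2 * n * (hR2 - hV2)
  have h4 : 1 / 2 * (R + V + s + t + 4 * n) * ((F * G⁻¹ - G * F⁻¹) / (f - g)) =
      n * (R + V) / (s - t) * (F * G⁻¹ - G * F⁻¹) := by
    have : R + V + s + t + 4 * n ≠ 0 := by positivity
    have : R + V ≠ 0 := by positivity
    rw [h2]
    field_simp
  rw [mul_div_assoc, h1, h4]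
  field_simp
  ring

theorem rational_part_eq {n s t R V : ℝ} (hn : 0 < n) (hs : 0 < s) (ht : 0 < t) (hst : s ≠ t)
    (hR2 : R ^ 2 = s ^ 2 + 4 * n * s) (hV2 : V ^ 2 = t ^ 2 + 4 * n * t) :
    ((s + 2 * n) / R ^ 2 - (t + 2 * n) / V ^ 2) / (s - t) =
      -(((s + 2 * n) * (t + 2 * n) + 4 * n ^ 2) / (R ^ 2 * V ^ 2)) := by
  have h3 : s - t ≠ 0 := sub_ne_zero.2 hst
  have h1 : s ^ 2 + 4 * n * s ≠ 0 := by positivity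
  have h2 : t ^ 2 + 4 * n * t ≠ 0 := by positivity
  rw [hR2, hV2, div_sub_div _ _ h1 h2, div_div, ← neg_div,
    div_eq_div_iff (mul_ne_zero (mul_ne_zero h1 h2) h3) (mul_ne_zero h1 h2)]
  ring

theorem rpow_half_mul {x : ℝ} (hx : 0 < x) (k : ℤ) : x ^ ((k : ℝ) / 2) = √x ^ k := by
  rw [Real.sqrt_eq_rpow, ← Real.rpow_intCast, ← Real.rpow_mul hx.le]
  congr 1; ring

theorem diagDensity_eq {κ : ι → ℝ} (hκ : ∀ i, 0 ≤ κ i) {n : ℕ} (hn : n ≠ 0)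
    (hdet : ∀ s : ℝ, 0 < s → diagDet κ s * √(s ^ 2 + 4 * n * s) = fDiff n s) {s t : ℝ}
    (hs : 0 < s) (ht : 0 < t) (hst : s ≠ t) :
    diagDensity κ s t = -integrandA n s t + integrandB n s t := by
  have hn' : (0 : ℝ) < n := by positivity
  have hR : 0 < √(s ^ 2 + 4 * n * s) := by positivity
  have hV : 0 < √(t ^ 2 + 4 * n * t) := by positivity
  have hP : 0 < fDiff n s := by rw [← hdet s hs]; exact mul_pos (diagDet_pos hκ hs.le) hR
  have hW : 0 < fDiff n t := by rw [← hdet t ht]; exact mul_pos (diagDet_pos hκ ht.le) hV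
  have hF : 0 < fRoot (s / n) ^ n := pow_pos (fRoot_pos (by positivity)) n
  have hG : 0 < fRoot (t / n) ^ n := pow_pos (fRoot_pos (by positivity)) n
  have hR2 : √(s ^ 2 + 4 * n * s) ^ 2 = s ^ 2 + 4 * n * s := Real.sq_sqrt (by positivity)
  have hV2 : √(t ^ 2 + 4 * n * t) ^ 2 = t ^ 2 + 4 * n * t := Real.sq_sqrt (by positivity)
  have hDs : diagDet κ s = fDiff n s / √(s ^ 2 + 4 * n * s) := by
    rw [← hdet s hs, mul_div_cancel_right₀ _ hR.ne']
  have hDt : diagDet κ t = fDiff n t / √(t ^ 2 + 4 * n * t) := by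
    rw [← hdet t ht, mul_div_cancel_right₀ _ hV.ne']
  have hB := bracket_eq hn' hs ht hst hR hV hF hG hR2 hV2 (fRoot_div_eq hn s) (fRoot_div_eq hn t)
  have hA := rational_part_eq hn' hs ht hst hR2 hV2
  have hst' : s - t ≠ 0 := sub_ne_zero.2 hst
  rw [diagDensity, sum_sq_div_eq hκ hs ht hst, sum_div_one_add_eq hκ hn hdet hs,
    sum_div_one_add_eq hκ hn hdet ht, integrandA, integrandB, hDs, hDt]
  simp only [zpow_neg, zpow_natCast]
  rw [hB, ← fDiff_eq, ← fDiff_eq]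
  have hprod : s * t * (s + 4 * n) * (t + 4 * n) =
      (√(s ^ 2 + 4 * n * s) * √(t ^ 2 + 4 * n * t)) ^ (2 : ℝ) := by
    rw [Real.rpow_two, mul_pow, hR2, hV2]; ring
  rw [hprod, ← Real.rpow_mul (by positivity), ← Real.rpow_mul (by positivity)]
  generalize √(s ^ 2 + 4 * n * s) = R at *
  generalize √(t ^ 2 + 4 * n * t) = V at *
  generalize fDiff n s = P at *
  generalize fDiff n t = W at *
  generalize fRoot (s / n) ^ n = F at *
  generalize fRoot (t / n) ^ n = G at *
  have e1 : (R * V) ^ ((2 : ℝ) * (3 / 4)) = √(R * V) ^ 3 := by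
    rw [show (2 : ℝ) * (3 / 4) = ((3 : ℤ) : ℝ) / 2 by norm_num, rpow_half_mul (by positivity)]
    rfl
  have e2 : (R * V) ^ ((2 : ℝ) * -(1 / 4)) = (√(R * V))⁻¹ := by
    rw [show (2 : ℝ) * -(1 / 4) = ((-1 : ℤ) : ℝ) / 2 by norm_num, rpow_half_mul (by positivity),
      zpow_neg_one]
  have e3 : ∀ {x : ℝ}, 0 < x → x ^ (-(1 / 2) : ℝ) = (√x)⁻¹ := fun hx => by
    rw [show -(1 / 2 : ℝ) = ((-1 : ℤ) : ℝ) / 2 by norm_num, rpow_half_mul hx, zpow_neg_one]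
  have e4 : ∀ {x : ℝ}, 0 < x → x ^ (-(3 / 2) : ℝ) = (√x ^ 3)⁻¹ := fun hx => by
    rw [show -(3 / 2 : ℝ) = ((-3 : ℤ) : ℝ) / 2 by norm_num, rpow_half_mul hx]
    rfl
  rw [e1, e2, e3 hP, e3 hW, e4 hP, e4 hW, Real.sqrt_mul hR.le, Real.sqrt_div hP.le,
    Real.sqrt_div hW.le]
  -- The divided difference of `(log D)'` separates into the rational part, which becomes `-A`, and
  -- the part from `f^n - f^(-n)`, which becomes `B`.
  have hsplit : (n * (G + G⁻¹) / (V * W) - (t + 2 * n) / V ^ 2 -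
      (n * (F + F⁻¹) / (R * P) - (s + 2 * n) / R ^ 2)) / (s - t) =
      -(((s + 2 * n) * (t + 2 * n) + 4 * n ^ 2) / (R ^ 2 * V ^ 2)) +
        n * ((G + G⁻¹) * P * R - (F + F⁻¹) * W * V) / (s - t) / (P * W * R * V) := by
    rw [← hA]
    field_simp
    ring
  rw [hsplit]
  generalize n * ((G + G⁻¹) * P * R - (F + F⁻¹) * W * V) / (s - t) = N
  generalize (s + 2 * n) * (t + 2 * n) + 4 * (n : ℝ) ^ 2 = M
  -- Writing each positive quantity as a square turns the remaining half-integer powers into a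
  -- rational identity.
  obtain ⟨r, hr, rfl⟩ : ∃ r, 0 < r ∧ R = r ^ 2 := ⟨√R, by positivity, (Real.sq_sqrt hR.le).symm⟩
  obtain ⟨v, hv, rfl⟩ : ∃ r, 0 < r ∧ V = r ^ 2 := ⟨√V, by positivity, (Real.sq_sqrt hV.le).symm⟩
  obtain ⟨p, hp, rfl⟩ : ∃ r, 0 < r ∧ P = r ^ 2 := ⟨√P, by positivity, (Real.sq_sqrt hP.le).symm⟩
  obtain ⟨w, hw, rfl⟩ : ∃ r, 0 < r ∧ W = r ^ 2 := ⟨√W, by positivity, (Real.sq_sqrt hW.le).symm⟩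
  rw [Real.sqrt_sq hr.le, Real.sqrt_sq hv.le, Real.sqrt_sq hp.le, Real.sqrt_sq hw.le]
  field_simp

end ClosedForm

/-! ### Diagonalization and the main theorem -/

section Diagonalization

variable {ι : Type*} [Fintype ι]

/-- The correlation coefficient of `x` and `y` for the quadratic form `Q`. -/
noncomputable def matrixCorr (Q : Matrix ι ι ℝ) (x y : ι → ℝ) : ℝ :=
  dotProduct x (Q.mulVec y) / (√(dotProduct x (Q.mulVec x)) * √(dotProduct y (Q.mulVec y)))

theorem measurable_matrixCorr (Q : Matrix ι ι ℝ) :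
    Measurable fun p : (ι → ℝ) × (ι → ℝ) => matrixCorr Q p.1 p.2 := by
  unfold matrixCorr dotProduct Matrix.mulVec dotProduct; fun_prop

variable [DecidableEq ι]

theorem det_one_add_smul_eq_diagDet {Q : Matrix ι ι ℝ} (hQ : Q.IsHermitian) (s : ℝ) :
    (1 + s • Q).det = diagDet hQ.eigenvalues s := by
  have h : 1 + s • Q = Unitary.conjStarAlgAut ℝ _ hQ.eigenvectorUnitary
      (1 + s • Matrix.diagonal hQ.eigenvalues) := by
    rw [map_add, map_one, map_smul]
    conv_lhs => rw [hQ.spectral_theorem]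
    rfl
  rw [h, Unitary.conjStarAlgAut_apply, Matrix.det_mul_right_comm, Unitary.mul_star_self_of_mem (SetLike.coe_mem _),
    one_mul, ← Matrix.diagonal_one, ← Matrix.diagonal_smul, Matrix.diagonal_add,
    Matrix.det_diagonal]
  simp [diagDet]

/-- The change of coordinates to an orthonormal basis of eigenvectors. -/
noncomputable def eigenCoord {Q : Matrix ι ι ℝ} (hQ : Q.IsHermitian) (x : ι → ℝ) : ι → ℝ :=
  WithLp.ofLp (∑ i, x i • hQ.eigenvectorBasis i)

theorem measurable_eigenCoord {Q : Matrix ι ι ℝ} (hQ : Q.IsHermitian) :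
    Measurable (eigenCoord hQ) := by
  unfold eigenCoord; fun_prop

/-- The standard Gaussian law on Euclidean space has independent standard coordinates in every
orthonormal basis; the eigenbasis is compared with the canonical one. -/
theorem map_eigenCoord {Q : Matrix ι ι ℝ} (hQ : Q.IsHermitian) :
    (Measure.pi fun _ : ι => gaussianReal 0 1).map (eigenCoord hQ) =
      Measure.pi fun _ : ι => gaussianReal 0 1 := by
  have h : eigenCoord hQ = WithLp.ofLp ∘ fun x : ι → ℝ => ∑ i, x i • hQ.eigenvectorBasis i := rfl
  rw [h, ← Measure.map_map (by fun_prop) (by fun_prop),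
    ← stdGaussian_eq_map_pi_orthonormalBasis hQ.eigenvectorBasis, ← map_pi_eq_stdGaussian,
    Measure.map_map (by fun_prop) (by fun_prop)]
  exact Measure.map_id

theorem eigenCoord_dotProduct_mulVec {Q : Matrix ι ι ℝ} (hQ : Q.IsHermitian) (x y : ι → ℝ) :
    dotProduct (eigenCoord hQ x) (Q.mulVec (eigenCoord hQ y)) =
      ∑ i, hQ.eigenvalues i * x i * y i := by
  have e : ∀ x : ι → ℝ, eigenCoord hQ x = ∑ i, x i • (hQ.eigenvectorBasis i).ofLp := fun x => by
    simp [eigenCoord]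
  have ho : ∀ i j, dotProduct (hQ.eigenvectorBasis i).ofLp (hQ.eigenvectorBasis j).ofLp =
      if i = j then 1 else 0 := fun i j => by
    have := orthonormal_iff_ite.1 hQ.eigenvectorBasis.orthonormal j i
    rw [EuclideanSpace.inner_eq_star_dotProduct] at this
    simpa [eq_comm] using this
  rw [e x, e y, Matrix.mulVec_sum, sum_dotProduct]
  refine Finset.sum_congr rfl fun i _ => ?_
  simp only [dotProduct_sum, Matrix.mulVec_smul, hQ.mulVec_eigenvectorBasis, smul_dotProduct,
    dotProduct_smul, ho, smul_eq_mul, mul_ite, mul_one, mul_zero, Finset.sum_ite_eq,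
    Finset.mem_univ, if_true]
  ring

theorem matrixCorr_eigenCoord {Q : Matrix ι ι ℝ} (hQ : Q.IsHermitian) (x y : ι → ℝ) :
    matrixCorr Q (eigenCoord hQ x) (eigenCoord hQ y) = diagCorr hQ.eigenvalues x y := by
  simp only [matrixCorr, diagCorr, eigenCoord_dotProduct_mulVec, sq, mul_assoc]

theorem measurePreserving_eigenCoord_prodMap {Q : Matrix ι ι ℝ} (hQ : Q.IsHermitian) :
    MeasurePreserving (Prod.map (eigenCoord hQ) (eigenCoord hQ))
      ((Measure.pi fun _ : ι => gaussianReal 0 1).prod (Measure.pi fun _ : ι => gaussianReal 0 1))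
      ((Measure.pi fun _ : ι => gaussianReal 0 1).prod
        (Measure.pi fun _ : ι => gaussianReal 0 1)) :=
  MeasurePreserving.prod ⟨measurable_eigenCoord hQ, map_eigenCoord hQ⟩
    ⟨measurable_eigenCoord hQ, map_eigenCoord hQ⟩

theorem integrable_matrixCorr_sq {Q : Matrix ι ι ℝ} (hQ : Q.PosSemidef) :
    Integrable (fun p : (ι → ℝ) × (ι → ℝ) => matrixCorr Q p.1 p.2 ^ 2)
      ((Measure.pi fun _ : ι => gaussianReal 0 1).prod
        (Measure.pi fun _ : ι => gaussianReal 0 1)) := by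
  rw [← (measurePreserving_eigenCoord_prodMap hQ.isHermitian).integrable_comp
    ((measurable_matrixCorr Q).pow_const 2).aestronglyMeasurable]
  refine Integrable.of_bound (Measurable.aestronglyMeasurable
    (((measurable_matrixCorr Q).pow_const 2).comp
      (measurePreserving_eigenCoord_prodMap hQ.isHermitian).measurable)) 1
    (Filter.Eventually.of_forall fun p => ?_)
  simp only [Function.comp, Prod.map, matrixCorr_eigenCoord]
  rw [Real.norm_of_nonneg (sq_nonneg _)]
  exact diagCorr_sq_le_one (fun i => hQ.eigenvalues_nonneg i) _ _

theorem integral_matrixCorr_sq {Q : Matrix ι ι ℝ} (hQ : Q.PosSemidef) :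
    ∫ p, matrixCorr Q p.1 p.2 ^ 2 ∂((Measure.pi fun _ : ι => gaussianReal 0 1).prod
        (Measure.pi fun _ : ι => gaussianReal 0 1)) =
      1 / 4 * ∫ q in Ioi (0 : ℝ) ×ˢ Ioi (0 : ℝ),
        diagDensity hQ.isHermitian.eigenvalues q.1 q.2 := by
  rw [← integral_diagCorr_sq fun i => hQ.eigenvalues_nonneg i]
  conv_lhs => rw [← (measurePreserving_eigenCoord_prodMap hQ.isHermitian).map_eq]
  rw [integral_map (measurePreserving_eigenCoord_prodMap hQ.isHermitian).aemeasurable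
    ((measurable_matrixCorr Q).pow_const 2).aestronglyMeasurable]
  simp only [Prod.map, matrixCorr_eigenCoord]

end Diagonalization

/-! ### The law of the steps and the conclusion -/

theorem map_steps_eq_pi_prod_pi {Ω : Type*} [MeasurableSpace Ω] {μ : Measure Ω}
    [IsProbabilityMeasure μ] {X Y : ℕ → Ω → ℝ}
    (hX : ∀ k, HasLaw (X k) (gaussianReal 0 1) μ) (hY : ∀ k, HasLaw (Y k) (gaussianReal 0 1) μ)
    (hXindep : iIndepFun X μ) (hYindep : iIndepFun Y μ)
    (hXY : IndepFun (fun ω k => X k ω) (fun ω k => Y k ω) μ) (m : ℕ) :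
    μ.map (fun ω => (fun j : Fin m => X (j + 1) ω, fun j : Fin m => Y (j + 1) ω)) =
      (Measure.pi fun _ : Fin m => gaussianReal 0 1).prod
        (Measure.pi fun _ : Fin m => gaussianReal 0 1) := by
  have hinj : Function.Injective fun j : Fin m => (j : ℕ) + 1 := fun i j h => by
    simpa [Fin.ext_iff] using h
  have hmX : ∀ j : Fin m, AEMeasurable (X (j + 1)) μ := fun j => (hX _).aemeasurable
  have hmY : ∀ j : Fin m, AEMeasurable (Y (j + 1)) μ := fun j => (hY _).aemeasurable
  have h : IndepFun (fun ω (j : Fin m) => X (j + 1) ω) (fun ω (j : Fin m) => Y (j + 1) ω) μ :=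
    hXY.comp (φ := fun (x : ℕ → ℝ) (j : Fin m) => x (j + 1))
      (ψ := fun (x : ℕ → ℝ) (j : Fin m) => x (j + 1)) (by fun_prop) (by fun_prop)
  rw [h.map_prod_eq_prod_map_map (aemeasurable_pi_lambda _ hmX) (aemeasurable_pi_lambda _ hmY),
    (hXindep.precomp hinj).map_fun_eq_pi_map hmX, (hYindep.precomp hinj).map_fun_eq_pi_map hmY]
  simp only [(hX _).map_eq, (hY _).map_eq]

theorem ae_fst_ne_snd : ∀ᵐ p : ℝ × ℝ, p.1 ≠ p.2 := by
  rw [Measure.volume_eq_prod]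
  refine (Measure.ae_prod_iff_ae_ae ?_).2 (Filter.Eventually.of_forall fun s => ?_)
  · exact (measurableSet_eq_fun measurable_fst measurable_snd).compl
  · filter_upwards [compl_mem_ae_iff.2 (measure_singleton (μ := volume) s)] with t ht h
    exact ht h.symm

theorem theorem4p1 {Ω : Type*} [MeasurableSpace Ω] (μ : Measure Ω) [IsProbabilityMeasure μ]
    (X Y : ℕ → Ω → ℝ)
    (hX : ∀ k, HasLaw (X k) (gaussianReal 0 1) μ) (hY : ∀ k, HasLaw (Y k) (gaussianReal 0 1) μ)
    (hXindep : iIndepFun X μ) (hYindep : iIndepFun Y μ)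
    (hXY : IndepFun (fun ω k => X k ω) (fun ω k => Y k ω) μ)
    (n : ℕ) (hn : 2 ≤ n) :
    Integrable (fun ω => empiricalCorr X Y n ω ^ 2) μ ∧
    IntegrableOn (fun p : ℝ × ℝ => -integrandA n p.1 p.2 + integrandB n p.1 p.2)
      (Ioi 0 ×ˢ Ioi 0) volume ∧
    ∫ ω, empiricalCorr X Y n ω ^ 2 ∂μ
      = 1 / 4 * ∫ s in Ioi (0 : ℝ), ∫ t in Ioi (0 : ℝ), (-integrandA n s t + integrandB n s t) := by
  obtain ⟨m, rfl⟩ : ∃ m, n = m + 1 := ⟨n - 1, by omega⟩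
  have hQ := bridgeMatrix_posSemidef m
  have hlaw := map_steps_eq_pi_prod_pi hX hY hXindep hYindep hXY m
  have hmeas : AEMeasurable
      (fun ω => (fun j : Fin m => X (j + 1) ω, fun j : Fin m => Y (j + 1) ω)) μ :=
    (aemeasurable_pi_lambda _ fun j => (hX _).aemeasurable).prodMk
      (aemeasurable_pi_lambda _ fun j => (hY _).aemeasurable)
  have hcorr : ∀ ω, empiricalCorr X Y (m + 1) ω =
      matrixCorr (bridgeMatrix m) (fun j => X (j + 1) ω) (fun j => Y (j + 1) ω) := fun ω => by
    simp only [empiricalCorr, matrixCorr, empiricalCov_eq_dotProduct]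
  have hκ : ∀ i, 0 ≤ hQ.isHermitian.eigenvalues i := fun i => hQ.eigenvalues_nonneg i
  -- The divided difference requires `s ≠ t`, so the closed form is an almost everywhere identity;
  -- the diagonal is null.
  have hdens : (fun p : ℝ × ℝ => diagDensity hQ.isHermitian.eigenvalues p.1 p.2)
      =ᵐ[volume.restrict (Ioi 0 ×ˢ Ioi 0)]
      fun p => -integrandA (m + 1) p.1 p.2 + integrandB (m + 1) p.1 p.2 := by
    filter_upwards [ae_restrict_mem (measurableSet_Ioi.prod measurableSet_Ioi),
      ae_restrict_of_ae ae_fst_ne_snd] with p hp hne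
    refine diagDensity_eq hκ m.succ_ne_zero (fun s hs => ?_) hp.1 hp.2 hne
    rw [← det_one_add_smul_eq_diagDet, det_one_add_smul_bridgeMatrix_mul_sqrt m hs]
  have hint : IntegrableOn
      (fun p : ℝ × ℝ => -integrandA (m + 1) p.1 p.2 + integrandB (m + 1) p.1 p.2)
      (Ioi 0 ×ˢ Ioi 0) volume := (integrableOn_diagDensity hκ).congr hdens
  have hsm := ((measurable_matrixCorr (bridgeMatrix m)).pow_const 2).aestronglyMeasurable
    (μ := μ.map (fun ω => (fun j : Fin m => X (j + 1) ω, fun j : Fin m => Y (j + 1) ω)))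
  simp only [hcorr]
  refine ⟨?_, hint, ?_⟩
  · have h := integrable_matrixCorr_sq hQ
    rw [← hlaw, integrable_map_measure hsm hmeas] at h
    exact h
  · have h := integral_matrixCorr_sq hQ
    rw [← hlaw, integral_map hmeas hsm, integral_congr_ae hdens] at h
    rw [h]
    congr 1
    exact setIntegral_prod _ hint
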